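/- For pairwise coprime integers $p,q,r\ge 3$ let \[ Q_{p,q,r}(z)=\frac{(z^{pqr}-1)(z^{p}-1)(z^{q}-1)(z^{r}-1)}{(z^{pq}-1)(z^{pr}-1)(z^{qr}-1)(z-1)}, \] which is a polynomial with integer coefficients, of degree $\varphi=(p-1)(q-1)(r-1)$ (the ternary inclusion-exclusion polynomial of $\{p,q,r\}$). Write $Q_{p,q,r}(z)=\sum_{m=0}^{\varphi}a_m z^m$ and put $\mathcal A_{p,q,r}=\{a_m:0\le m\le\varphi\}$, $A^+_{p,q,r}=\max_m a_m$, $A^-_{p,q,r}=\min_m a_m$. (1) For all pairwise coprime integers $p,q,r\ge3$, $\mathcal A_{p,q,r}=[A^-_{p,q,r},A^+_{p,q,r}]\cap\mathbb Z$. (2) Let $p,q\ge3$ be coprime and let $r,s>\max(p,q)$ be integers coprime to $p$ and to $q$. If $r\equiv s\pmod{pq}$, then $\mathcal A_{p,q,r}=\mathcal A_{p,q,s}$; if $r\equiv -s\pmod{pq}$, then $\mathcal A_{p,q,r}=-\mathcal A_{p,q,s}$. (3) In particular, let $p,q$ be distinct odd primes. For every odd prime $r\ne p,q$, the set of coefficients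 $a_m$, $0\le m\le\deg\Phi_{pqr}$, of the cyclotomic polynomial $\Phi_{pqr}$ consists of all the integers between its minimum and its maximum. For primes $r,s>\max(p,q)$, this set equals that of $\Phi_{pqs}$ if $r\equiv s\pmod{pq}$, and the negative of that of $\Phi_{pqs}$ if $r\equiv -s\pmod{pq}$. -/

import Mathlib

open Polynomial
open scoped Pointwise

/-- Numerator of the inclusion-exclusion fraction: the product of `X ^ n_S - 1` over the subsets
`S` of `ρ` with an even number of elements, where `n_S` is the product of all elements of `ρ`
divided by the product of the elements of `S`, that is, the product over `ρ \ S`. -/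
noncomputable def inclExclNum (ρ : Finset ℕ) : ℤ[X] :=
  ∏ S ∈ ρ.powerset with Even S.card, (X ^ (∏ i ∈ ρ \ S, i) - 1)

/-- Denominator of the inclusion-exclusion fraction: the same product over the subsets `S` with an
odd number of elements. -/
noncomputable def inclExclDen (ρ : Finset ℕ) : ℤ[X] :=
  ∏ S ∈ ρ.powerset with ¬ Even S.card, (X ^ (∏ i ∈ ρ \ S, i) - 1)

/-- The inclusion-exclusion polynomial `Q_ρ`, the quotient of `inclExclNum ρ` by the monic
polynomial `inclExclDen ρ`. For pairwise coprime positive elements the division is exact,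
see `inclExclDen_mul_inclExclPoly`. -/
noncomputable def inclExclPoly (ρ : Finset ℕ) : ℤ[X] :=
  inclExclNum ρ /ₘ inclExclDen ρ

/-- The set of the coefficients `a_0, …, a_n` of a polynomial of degree `n`. -/
noncomputable def coeffSet (P : ℤ[X]) : Finset ℤ :=
  (Finset.range (P.natDegree + 1)).image P.coeff

theorem coeffSet_nonempty (P : ℤ[X]) : (coeffSet P).Nonempty :=
  Finset.Nonempty.image ⟨0, by simp⟩ _

/-- `A⁺`: the largest coefficient. -/
noncomputable def maxCoeff (P : ℤ[X]) : ℤ := (coeffSet P).max' (coeffSet_nonempty P)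

/-- `A⁻`: the smallest coefficient. -/
noncomputable def minCoeff (P : ℤ[X]) : ℤ := (coeffSet P).min' (coeffSet_nonempty P)

theorem inclExclDen_monic (ρ : Finset ℕ) (hpos : ∀ r ∈ ρ, 0 < r) : (inclExclDen ρ).Monic := by
  refine monic_prod_of_monic _ _ fun S _ => ?_
  have h : (∏ i ∈ ρ \ S, i) ≠ 0 :=
    (Finset.prod_pos fun i hi => hpos i (Finset.mem_sdiff.1 hi).1).ne'
  simpa using monic_X_pow_sub_C (1 : ℤ) h

theorem inclExclDen_dvd_inclExclNum (ρ : Finset ℕ) (hpos : ∀ r ∈ ρ, 0 < r)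
    (hco : (ρ : Set ℕ).Pairwise Nat.Coprime) : inclExclDen ρ ∣ inclExclNum ρ := by
  classical
  have hn0 : (∏ i ∈ ρ, i) ≠ 0 := (Finset.prod_pos hpos).ne'
  have hfac : ∀ S ∈ ρ.powerset, (X ^ (∏ i ∈ ρ \ S, i) - 1 : ℤ[X]) =
      ∏ d ∈ (∏ i ∈ ρ, i).divisors,
        if (∀ r ∈ S, Nat.Coprime d r) then cyclotomic d ℤ else 1 := by
    intro S hS
    have hS' := Finset.mem_powerset.1 hS
    have h : 0 < ∏ i ∈ ρ \ S, i :=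
      Finset.prod_pos fun i hi => hpos i (Finset.mem_sdiff.1 hi).1
    have hmul : (∏ i ∈ ρ \ S, i) * ∏ i ∈ S, i = ∏ i ∈ ρ, i := Finset.prod_sdiff hS'
    rw [← prod_cyclotomic_eq_X_pow_sub_one h, ← Finset.prod_filter]
    refine Finset.prod_congr ?_ fun _ _ => rfl
    ext d
    simp only [Nat.mem_divisors, Finset.mem_filter]
    constructor
    · rintro ⟨hd, -⟩
      refine ⟨⟨hd.trans ⟨_, hmul.symm⟩, hn0⟩, fun r hr => Nat.Coprime.coprime_dvd_left hd ?_⟩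
      refine Nat.Coprime.prod_left fun i hi => ?_
      have hi' := Finset.mem_sdiff.1 hi
      refine hco hi'.1 (hS' hr) ?_
      rintro rfl
      exact hi'.2 hr
    · rintro ⟨⟨hd, -⟩, hc⟩
      rw [← hmul] at hd
      exact ⟨(Nat.Coprime.prod_right hc).dvd_of_dvd_mul_right hd, h.ne'⟩
  have hN : inclExclNum ρ = ∏ d ∈ (∏ i ∈ ρ, i).divisors,
      ∏ S ∈ ρ.powerset with Even S.card,
        if (∀ r ∈ S, Nat.Coprime d r) then cyclotomic d ℤ else 1 := by
    rw [Finset.prod_comm]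
    exact Finset.prod_congr rfl fun S hS => hfac S (Finset.mem_filter.1 hS).1
  have hD : inclExclDen ρ = ∏ d ∈ (∏ i ∈ ρ, i).divisors,
      ∏ S ∈ ρ.powerset with ¬ Even S.card,
        if (∀ r ∈ S, Nat.Coprime d r) then cyclotomic d ℤ else 1 := by
    rw [Finset.prod_comm]
    exact Finset.prod_congr rfl fun S hS => hfac S (Finset.mem_filter.1 hS).1
  rw [hN, hD]
  refine Finset.prod_dvd_prod_of_dvd _ _ fun d _ => ?_
  rw [← Finset.prod_filter, ← Finset.prod_filter, Finset.prod_const, Finset.prod_const]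
  refine pow_dvd_pow _ ?_
  set T := ρ.filter fun r => Nat.Coprime d r with hT
  have key : ∀ S, (S ∈ ρ.powerset ∧ ∀ r ∈ S, Nat.Coprime d r) ↔ S ∈ T.powerset := by
    intro S
    simp only [Finset.mem_powerset, hT, Finset.subset_iff, Finset.mem_filter]
    exact ⟨fun h r hr => ⟨h.1 hr, h.2 r hr⟩, fun h => ⟨fun r hr => (h hr).1, fun r hr => (h hr).2⟩⟩
  have e1 : ((ρ.powerset.filter fun S => Even S.card).filter fun S => ∀ r ∈ S, Nat.Coprime d r) =
      T.powerset.filter fun S => Even S.card := by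
    ext S
    simp only [Finset.mem_filter, ← key]
    tauto
  have e2 : ((ρ.powerset.filter fun S => ¬ Even S.card).filter fun S => ∀ r ∈ S, Nat.Coprime d r) =
      T.powerset.filter fun S => ¬ Even S.card := by
    ext S
    simp only [Finset.mem_filter, ← key]
    tauto
  rw [e1, e2]
  have hs := Finset.sum_powerset_neg_one_pow_card (x := T)
  rw [← Finset.sum_filter_add_sum_filter_not T.powerset fun S => Even S.card] at hs
  rw [Finset.sum_congr rfl (g := fun _ => (1 : ℤ))
      fun S hS => (Finset.mem_filter.1 hS).2.neg_one_pow,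
    Finset.sum_congr (s₁ := T.powerset.filter fun S => ¬ Even S.card) rfl (g := fun _ => (-1 : ℤ))
      fun S hS => (Nat.not_even_iff_odd.1 (Finset.mem_filter.1 hS).2).neg_one_pow] at hs
  simp only [Finset.sum_const, nsmul_eq_mul, mul_one, mul_neg] at hs
  split_ifs at hs <;> omega

/-- The quotient defining `inclExclPoly` is exact. -/
theorem inclExclDen_mul_inclExclPoly (ρ : Finset ℕ) (hpos : ∀ r ∈ ρ, 0 < r)
    (hco : (ρ : Set ℕ).Pairwise Nat.Coprime) :
    inclExclDen ρ * inclExclPoly ρ = inclExclNum ρ := by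
  have h := inclExclDen_dvd_inclExclNum ρ hpos hco
  have hm := inclExclDen_monic ρ hpos
  have := modByMonic_add_div (inclExclNum ρ) (inclExclDen ρ)
  rwa [(modByMonic_eq_zero_iff_dvd hm).2 h, zero_add] at this

/-! Let `P`, with coefficients `c m`, be the binary polynomial of `p, q`. Cancelling factors gives
Q(z) = P(z^r) W(z), where W = (z^p - 1)(z^q - 1) / ((z^(pq) - 1)(z - 1)) is a power series whose
coefficients `window` have period pq. So the n-th coefficient of Q is the sum of `c m * window (n -
r m)` over m ≤ n / r (`coeff_eq_windowSum`).

Absence of gaps: consecutive coefficients of Q differ by at most 1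
(`abs_coeff_succ_sub_coeff_le_one`), so every integer between the minimum and the maximum occurs.
Indeed the difference of `window` is a signed sum of indicators of four classes modulo pq, and each
class meets the support of P at most once. The four resulting terms sit at the corners of a
rectangle and cannot add up to more than 1 in absolute value.

Dependence on r: let t be any integer and N any cutoff in the sum. The values so obtained depend on
r only modulo pq, and replacing r by -r negates them, by a symmetry of `window`. For p < q < r each
such value lies between two coefficients of Q (`exists_windowSum_le_coeff`), because two consecutive
coefficients of P never have the same nonzero sign. Hence this family, in which the size of r plays
no role, determines the interval of coefficients. -/

/-! ### The binary polynomial and the signs of its coefficients. -/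

/-- Take `a` inverse to `p` modulo `q` and `b'` with pa = qb' + 1. The symmetric form chosen here
also yields qb = pa' + 1 and pa + qb = pq + 1. -/
theorem exists_add_eq_and_mul_eq {p q : ℕ} (hp : 1 < p) (hq : 1 < q) (h : Nat.Coprime p q) :
    ∃ a a' b b' : ℕ, a + a' = q ∧ b + b' = p ∧ a * b = a' * b' + 1 := by
  obtain ⟨m, hm, hm1⟩ := Nat.exists_mul_mod_eq_one_of_coprime h hq
  have hk := Nat.div_add_mod (p * m) q
  rw [hm1] at hk
  generalize p * m / q = k at hk
  have hkp : k ≤ p := by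
    by_contra! hlt
    nlinarith
  obtain ⟨b, rfl⟩ := Nat.exists_eq_add_of_le hkp
  obtain ⟨a', rfl⟩ := Nat.exists_eq_add_of_le hm.le
  refine ⟨m, a', b, k, rfl, by ring, ?_⟩
  nlinarith

/-- An explicit form of the binary polynomial `(X ^ (p q) - 1)(X - 1) / ((X ^ p - 1)(X ^ q - 1))`. -/
theorem binary_eq {p q a a' b b' : ℕ} {P : ℤ[X]} (hp : 0 < p) (hq : 0 < q)
    (hP : P * ((X ^ p - 1) * (X ^ q - 1)) = (X ^ (p * q) - 1) * (X - 1))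
    (ha : a + a' = q) (hb : b + b' = p) (hab : a * b = a' * b' + 1) :
    P = (∑ x ∈ Finset.range a, (X ^ p) ^ x) * (∑ y ∈ Finset.range b, (X ^ q) ^ y) -
      X * ((∑ x ∈ Finset.range a', (X ^ p) ^ x) * (∑ y ∈ Finset.range b', (X ^ q) ^ y)) := by
  have hp1 : (X ^ p - 1 : ℤ[X]) ≠ 0 := by
    simpa using (monic_X_pow_sub_C (1 : ℤ) hp.ne').ne_zero
  have hq1 : (X ^ q - 1 : ℤ[X]) ≠ 0 := by
    simpa using (monic_X_pow_sub_C (1 : ℤ) hq.ne').ne_zero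
  refine mul_right_cancel₀ (mul_ne_zero hp1 hq1) (hP.trans ?_)
  have e1 := geom_sum_mul (X ^ p : ℤ[X]) a
  have e2 := geom_sum_mul (X ^ q : ℤ[X]) b
  have e3 := geom_sum_mul (X ^ p : ℤ[X]) a'
  have e4 := geom_sum_mul (X ^ q : ℤ[X]) b'
  rw [← pow_mul] at e1 e2 e3 e4
  have h1 : p * a = q * b' + 1 := by subst ha hb; nlinarith
  have h2 : q * b = p * a' + 1 := by subst ha hb; nlinarith
  have h3 : p * q = p * a' + q * b' + 1 := by subst ha hb; nlinarith
  rw [h1] at e1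
  rw [h2] at e2
  rw [h3]
  linear_combination (-(∑ y ∈ Finset.range b, (X ^ q) ^ y) * (X ^ q - 1)) * e1 -
    (X ^ (q * b' + 1) - 1) * e2 +
    X * (∑ y ∈ Finset.range b', (X ^ q) ^ y) * (X ^ q - 1) * e3 + X * (X ^ (p * a') - 1) * e4

theorem binary_coeff {p q a a' b b' : ℕ} {P : ℤ[X]} (hp : 0 < p) (hq : 0 < q)
    (hP : P * ((X ^ p - 1) * (X ^ q - 1)) = (X ^ (p * q) - 1) * (X - 1))
    (ha : a + a' = q) (hb : b + b' = p) (hab : a * b = a' * b' + 1) (m : ℕ) :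
    P.coeff m =
      (∑ x ∈ Finset.range a, ∑ y ∈ Finset.range b, if m = p * x + q * y then (1 : ℤ) else 0) -
      ∑ x ∈ Finset.range a', ∑ y ∈ Finset.range b',
        if m = p * x + q * y + 1 then (1 : ℤ) else 0 := by
  rw [binary_eq hp hq hP ha hb hab, Finset.sum_mul_sum, Finset.sum_mul_sum, coeff_sub]
  simp only [Finset.mul_sum, finsetSum_coeff, ← pow_mul, ← pow_add, ← pow_succ', coeff_X_pow]

/-- Positive coefficients sit at px + qy with (x, y) in the box a × b. Writing 1 = pa + qb - pq, two
such exponents at distance 1 would differ by a vector too long for the box. -/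
theorem binary_coeff_not_both_pos {p q : ℕ} {P : ℤ[X]} (hp : 1 < p) (hq : 1 < q)
    (hpq : Nat.Coprime p q)
    (hP : P * ((X ^ p - 1) * (X ^ q - 1)) = (X ^ (p * q) - 1) * (X - 1)) (m : ℕ)
    (h : 0 < P.coeff m) : P.coeff (m + 1) ≤ 0 := by
  obtain ⟨a, a', b, b', ha, hb, hab⟩ := exists_add_eq_and_mul_eq hp hq hpq
  have key : ∀ m, 0 < P.coeff m → ∃ x y, x < a ∧ y < b ∧ m = p * x + q * y := by
    intro m hm
    by_contra! hne
    rw [binary_coeff (by omega) (by omega) hP ha hb hab, Finset.sum_eq_zero, zero_sub] at hm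
    · have : (0 : ℤ) ≤ ∑ x ∈ Finset.range a', ∑ y ∈ Finset.range b',
        if m = p * x + q * y + 1 then (1 : ℤ) else 0 :=
        Finset.sum_nonneg fun x _ => Finset.sum_nonneg fun y _ => by split_ifs <;> simp
      linarith
    · intro x hx
      refine Finset.sum_eq_zero fun y hy => if_neg ?_
      exact hne x y (Finset.mem_range.1 hx) (Finset.mem_range.1 hy)
  by_contra! h'
  obtain ⟨x, y, hx, hy, e⟩ := key m h
  obtain ⟨x', y', hx', hy', e'⟩ := key _ h'
  have hrel : p * a + q * b = p * q + 1 := by subst ha hb; nlinarith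
  zify at hp hq hx hy hx' hy' e e' hrel ha hb
  have e2 : (p : ℤ) * (x' - x - a + q) = q * (b + y - y') := by linear_combination e - e' - hrel
  have hd : (q : ℤ) ∣ x' - x - a + q :=
    (Nat.isCoprime_iff_coprime.2 hpq.symm).dvd_of_dvd_mul_left ⟨_, e2⟩
  obtain ⟨k, hk⟩ := hd
  rw [hk] at e2
  -- x' < a forces k < 1, whereas y' < b makes pk = b + y - y' positive.
  have hk1 : k < 1 := by nlinarith
  have hk2 : (p : ℤ) * k = b + y - y' := by
    have : (q : ℤ) ≠ 0 := by omega
    apply mul_left_cancel₀ this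
    linarith
  nlinarith

theorem binary_coeff_not_both_neg {p q : ℕ} {P : ℤ[X]} (hp : 1 < p) (hq : 1 < q)
    (hpq : Nat.Coprime p q)
    (hP : P * ((X ^ p - 1) * (X ^ q - 1)) = (X ^ (p * q) - 1) * (X - 1)) (m : ℕ)
    (h : P.coeff m < 0) : 0 ≤ P.coeff (m + 1) := by
  obtain ⟨a, a', b, b', ha, hb, hab⟩ := exists_add_eq_and_mul_eq hp hq hpq
  have key : ∀ m, P.coeff m < 0 → ∃ x y, x < a' ∧ y < b' ∧ m = p * x + q * y + 1 := by
    intro m hm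
    by_contra! hne
    rw [binary_coeff (by omega) (by omega) hP ha hb hab, sub_neg] at hm
    rw [Finset.sum_eq_zero (s := Finset.range a')] at hm
    · have : (0 : ℤ) ≤ ∑ x ∈ Finset.range a, ∑ y ∈ Finset.range b,
        if m = p * x + q * y then (1 : ℤ) else 0 :=
        Finset.sum_nonneg fun x _ => Finset.sum_nonneg fun y _ => by split_ifs <;> simp
      linarith
    · intro x hx
      refine Finset.sum_eq_zero fun y hy => if_neg ?_
      exact hne x y (Finset.mem_range.1 hx) (Finset.mem_range.1 hy)
  by_contra! h'
  obtain ⟨x, y, hx, hy, e⟩ := key m h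
  obtain ⟨x', y', hx', hy', e'⟩ := key _ h'
  have hrel : p * a + q * b = p * q + 1 := by subst ha hb; nlinarith
  zify at hp hq hx hy hx' hy' e e' hrel ha hb
  have e2 : (p : ℤ) * (x' - x - a + q) = q * (b + y - y') := by linear_combination e - e' - hrel
  have hd : (q : ℤ) ∣ x' - x - a + q :=
    (Nat.isCoprime_iff_coprime.2 hpq.symm).dvd_of_dvd_mul_left ⟨_, e2⟩
  obtain ⟨k, hk⟩ := hd
  rw [hk] at e2
  -- Here q - a = a' > x makes k positive, whereas y < b' gives pk < b + b' = p.
  have hk1 : 0 < k := by nlinarith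
  have hk2 : (p : ℤ) * k = b + y - y' := by
    have : (q : ℤ) ≠ 0 := by omega
    apply mul_left_cancel₀ this
    linarith
  nlinarith

/-! ### The periodic power series coefficients. -/

/-- The indicator function of the residues `0, …, p - 1` modulo `p q`. -/
def initialInd (p q : ℕ) (t : ℤ) : ℤ := if t % ((p : ℤ) * q) < p then 1 else 0

/-- The indicator of `0, …, p - 1` minus that of `q, …, q + p - 1`, modulo `p q`. These are the
coefficients of the power series `(1 - X ^ p)(1 - X ^ q) / ((1 - X)(1 - X ^ (p q)))`. -/
def window (p q : ℕ) (t : ℤ) : ℤ := initialInd p q t - initialInd p q (t - q)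

theorem initialInd_eq {p q : ℕ} {t : ℤ} (d k : ℤ) (h : t = (p : ℤ) * q * d + k) (h0 : 0 ≤ k)
    (h1 : k < (p : ℤ) * q) : initialInd p q t = if k < p then 1 else 0 := by
  rw [initialInd, h, Int.mul_add_emod_self_left, Int.emod_eq_of_lt h0 h1]

theorem initialInd_congr {p q : ℕ} {t u : ℤ} (h : t ≡ u [ZMOD ((p : ℤ) * q)]) :
    initialInd p q t = initialInd p q u := by
  rw [initialInd, initialInd, h]

theorem window_congr {p q : ℕ} {t u : ℤ} (h : t ≡ u [ZMOD ((p : ℤ) * q)]) :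
    window p q t = window p q u := by
  rw [window, window, initialInd_congr h, initialInd_congr (h.sub_right _)]

theorem initialInd_reflect {p q : ℕ} (hp : 0 < p) (hq : 0 < q) (t : ℤ) :
    initialInd p q (p - 1 - t) = initialInd p q t := by
  have hM : (0 : ℤ) < (p : ℤ) * q := by positivity
  have hpM : (p : ℤ) ≤ (p : ℤ) * q := by nlinarith
  have e := Int.emod_add_mul_ediv t ((p : ℤ) * q)
  have h0 := Int.emod_nonneg t hM.ne'
  have h1 := Int.emod_lt_of_pos t hM
  generalize t % ((p : ℤ) * q) = k at *
  generalize t / ((p : ℤ) * q) = d at *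
  rw [initialInd_eq (t := t) d k (by linarith) h0 h1]
  by_cases hk : k < p
  · rw [initialInd_eq (-d) (p - 1 - k) (by linarith) (by linarith) (by linarith), if_pos hk,
      if_pos (by linarith)]
  · rw [initialInd_eq (-d - 1) (p - 1 - k + p * q) (by linarith) (by linarith) (by linarith),
      if_neg hk, if_neg (by linarith)]

/-- The reflection exchanges the two blocks 0, …, p - 1 and q, …, q + p - 1, which carry opposite
signs. -/
theorem window_reflect {p q : ℕ} (hp : 0 < p) (hq : 0 < q) (t : ℤ) :
    window p q (p + q - 1 - t) = -window p q t := by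
  rw [window, window, ← initialInd_reflect hp hq (t - q), ← initialInd_reflect hp hq t]
  ring_nf

theorem initialInd_sub {p q : ℕ} (hp : 0 < p) (hq : 1 < q) (t : ℤ) :
    initialInd p q t - initialInd p q (t - 1) =
      (if (p : ℤ) * q ∣ t then 1 else 0) - if (p : ℤ) * q ∣ t - p then 1 else 0 := by
  have hM : (0 : ℤ) < (p : ℤ) * q := by positivity
  have hpM : (p : ℤ) < (p : ℤ) * q := by nlinarith
  have e := Int.emod_add_mul_ediv t ((p : ℤ) * q)
  have h0 := Int.emod_nonneg t hM.ne'
  have h1 := Int.emod_lt_of_pos t hM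
  generalize t % ((p : ℤ) * q) = k at *
  generalize t / ((p : ℤ) * q) = d at *
  generalize hMM : (p : ℤ) * q = M at *
  have d1 : M ∣ t ↔ k = 0 := by
    rw [← e, Int.dvd_add_left ⟨d, rfl⟩]
    exact ⟨fun h => Int.eq_zero_of_dvd_of_nonneg_of_lt h0 h1 h, fun h => h ▸ dvd_zero _⟩
  have d2 : M ∣ t - p ↔ k = p := by
    rw [← e, add_sub_right_comm, Int.dvd_add_left ⟨d, rfl⟩]
    refine ⟨fun h => ?_, fun h => by simp [h]⟩
    have := Int.eq_zero_of_abs_lt_dvd h (by rw [abs_lt]; constructor <;> linarith)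
    linarith
  rw [initialInd_eq (t := t) d k (by rw [hMM]; linarith) h0 (by rw [hMM]; linarith)]
  simp only [d1, d2]
  by_cases hk : k = 0
  · rw [initialInd_eq (t := t - 1) (d - 1) (M - 1) (by rw [hMM]; linarith) (by linarith)
      (by rw [hMM]; linarith)]
    split_ifs <;> omega
  · rw [initialInd_eq (t := t - 1) d (k - 1) (by rw [hMM]; linarith) (by omega)
      (by rw [hMM]; linarith)]
    split_ifs <;> omega

theorem window_sub {p q : ℕ} (hp : 0 < p) (hq : 1 < q) (t : ℤ) :
    window p q t - window p q (t - 1) =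
      (if (p : ℤ) * q ∣ t then 1 else 0) - (if (p : ℤ) * q ∣ t - p then 1 else 0) -
      (if (p : ℤ) * q ∣ t - q then 1 else 0) + if (p : ℤ) * q ∣ t - p - q then 1 else 0 := by
  have h1 := initialInd_sub hp hq t
  have h2 := initialInd_sub hp hq (t - q)
  rw [window, window, show t - 1 - (q : ℤ) = t - q - 1 by ring,
    show t - p - (q : ℤ) = t - q - p by ring]
  linarith

theorem window_of_lt {p q : ℕ} (hp : 1 < p) (hq : 1 < q) {n : ℕ} (hn : n < p * q) :
    window p q n = (if n < p then 1 else 0) - if q ≤ n ∧ n < q + p then 1 else 0 := by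
  have h1 : (p : ℤ) + q ≤ p * q := by nlinarith
  have hn' : (n : ℤ) < p * q := by exact_mod_cast hn
  rw [window, initialInd_eq (t := n) 0 n (by ring) (by positivity) hn']
  by_cases h : q ≤ n
  · rw [initialInd_eq (t := n - q) 0 (n - q) (by ring) (by omega) (by linarith)]
    split_ifs <;> omega
  · rw [initialInd_eq (t := n - q) (-1) (n - q + p * q) (by ring) (by omega) (by omega)]
    split_ifs <;> omega

theorem window_neg_one {p q : ℕ} (hp : 2 < p) (hq : 1 < q) : window p q (-1) = 0 := by
  have h1 : (p : ℤ) + q < p * q := by nlinarith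
  rw [window, initialInd_eq (t := -1) (-1) (p * q - 1) (by ring) (by linarith) (by linarith),
    initialInd_eq (t := -1 - q) (-1) (p * q - 1 - q) (by ring) (by linarith) (by linarith)]
  split_ifs <;> omega

theorem mk_window_mul {p q : ℕ} (hp : 1 < p) (hq : 1 < q) :
    PowerSeries.mk (fun n : ℕ => window p q n) *
      ((PowerSeries.X ^ (p * q) - 1) * (PowerSeries.X - 1)) =
    (PowerSeries.X ^ p - 1) * (PowerSeries.X ^ q - 1) := by
  have hpq : p + q ≤ p * q := by nlinarith
  have h : PowerSeries.mk (fun n : ℕ => window p q n) * (PowerSeries.X ^ (p * q) - 1) =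
      (∑ i ∈ Finset.range p, PowerSeries.X ^ i) * (PowerSeries.X ^ q - 1) := by
    ext n
    have hw : n < p * q → _ := window_of_lt hp hq
    simp only [mul_sub, mul_one, map_sub, PowerSeries.coeff_mul_X_pow', PowerSeries.coeff_mk,
      map_sum, PowerSeries.coeff_X_pow, Finset.sum_ite_eq, Finset.mem_range]
    by_cases hn : p * q ≤ n
    · rw [if_pos hn, window_congr (t := ((n - p * q : ℕ) : ℤ)) (u := n), sub_self]
      · split_ifs <;> omega
      · rw [Nat.cast_sub hn, Nat.cast_mul]
        simp [Int.ModEq]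
    · rw [if_neg hn, hw (by omega)]
      split_ifs <;> omega
  rw [← mul_assoc, h, mul_right_comm, geom_sum_mul]

/-! ### Coefficients of Q as truncated sums. -/

/-- The sum `∑ c m * window (t - r m)` over `m < N`. -/
def windowSum (c : ℕ → ℤ) (p q : ℕ) (r t : ℤ) (N : ℕ) : ℤ :=
  ∑ m ∈ Finset.range N, c m * window p q (t - r * m)

/-- This is the Cauchy product of P(z^r) with the series of `window`. The cutoff matters: `window`
is periodic on all of ℤ and need not vanish at negative arguments. -/
theorem coeff_eq_windowSum {p q r : ℕ} {P Q : ℤ[X]} (hp : 1 < p) (hq : 1 < q) (hr : 0 < r)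
    (hQ : Q * ((X ^ (p * q) - 1) * (X - 1)) = expand ℤ r P * ((X ^ p - 1) * (X ^ q - 1)))
    (n : ℕ) : Q.coeff n = windowSum P.coeff p q r n (n / r + 1) := by
  have hD : ((X ^ (p * q) - 1) * (X - 1) : ℤ[X]) ≠ 0 := by
    refine mul_ne_zero ?_ (X_sub_C_ne_zero 1)
    simpa using (monic_X_pow_sub_C (1 : ℤ) (n := p * q) (by positivity)).ne_zero
  have hD' : ((PowerSeries.X ^ (p * q) - 1) * (PowerSeries.X - 1) : PowerSeries ℤ) ≠ 0 := by
    have := (Polynomial.coe_injective ℤ).ne hD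
    simpa using this
  have hps : (Q : PowerSeries ℤ) = (expand ℤ r P : ℤ[X]) *
      PowerSeries.mk (fun n : ℕ => window p q n) := by
    refine mul_right_cancel₀ hD' ?_
    rw [mul_assoc, mk_window_mul hp hq]
    have := congrArg (fun R : ℤ[X] => (R : PowerSeries ℤ)) hQ
    simpa using this
  rw [← Polynomial.coeff_coe, hps, PowerSeries.coeff_mul,
    Finset.Nat.sum_antidiagonal_eq_sum_range_succ_mk, windowSum]
  symm
  refine Finset.sum_of_injOn (fun m => r * m) ?_ ?_ ?_ ?_
  · intro x _ y _ h
    exact Nat.eq_of_mul_eq_mul_left hr h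
  · intro m hm
    simp only [Finset.coe_range, Set.mem_Iio] at hm ⊢
    have := (Nat.le_div_iff_mul_le hr).1 (Nat.lt_succ_iff.1 hm)
    rw [mul_comm]
    omega
  · intro k hk hk'
    simp only [coeff_coe, coeff_expand hr]
    rw [if_neg, zero_mul]
    rintro ⟨m, rfl⟩
    refine hk' ⟨m, ?_, rfl⟩
    simp only [Finset.coe_range, Set.mem_Iio, Finset.mem_range] at hk ⊢
    rw [Nat.lt_succ_iff, Nat.le_div_iff_mul_le hr, mul_comm]
    omega
  · intro m hm
    have hm' : r * m ≤ n := by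
      have := (Nat.le_div_iff_mul_le hr).1 (Nat.lt_succ_iff.1 (Finset.mem_range.1 hm))
      rwa [mul_comm]
    simp only [coeff_coe, coeff_expand_mul' hr, PowerSeries.coeff_mk]
    rw [Nat.cast_sub hm', Nat.cast_mul]

/-! ### Residue classes and the jump bound. -/

theorem exists_lt_dvd_sub_mul {u : ℤ} {q : ℕ} (hq : 0 < q) (h : IsCoprime u (q : ℤ)) (t : ℤ) :
    ∃ x < q, (q : ℤ) ∣ t - u * x := by
  obtain ⟨v, w, hvw⟩ := h
  have hq' : (0 : ℤ) < q := by exact_mod_cast hq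
  obtain ⟨x, hx⟩ := Int.eq_ofNat_of_zero_le (Int.emod_nonneg (v * t) hq'.ne')
  have hlt := Int.emod_lt_of_pos (v * t) hq'
  have e := Int.emod_add_mul_ediv (v * t) q
  rw [hx] at hlt e
  refine ⟨x, by exact_mod_cast hlt, w * t + u * (v * t / q), ?_⟩
  linear_combination -u * e - t * hvw

theorem mul_dvd_sub_iff {p q x y x₀ y₀ : ℕ} {r t : ℤ} (hpq : IsCoprime (p : ℤ) q)
    (hrp : IsCoprime r (p : ℤ)) (hrq : IsCoprime r (q : ℤ)) (hx : x < q) (hx₀ : x₀ < q)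
    (hy : y < p) (hy₀ : y₀ < p) (hxt : (q : ℤ) ∣ t - r * p * x₀) (hyt : (p : ℤ) ∣ t - r * q * y₀) :
    ((p : ℤ) * q ∣ t - r * (p * x + q * y)) ↔ x = x₀ ∧ y = y₀ := by
  constructor
  · intro h
    constructor
    · have h1 : (q : ℤ) ∣ (r * p) * (x₀ - x) := by
        have h2 := dvd_add (dvd_sub ((Dvd.intro_left _ rfl).trans h) hxt)
          (Dvd.intro (r * y) rfl : (q : ℤ) ∣ q * (r * y))
        rwa [show t - r * (p * x + q * y) - (t - r * p * x₀) + q * (r * y) = r * p * (x₀ - x) by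
          ring] at h2
      have h2 := (hrq.mul_left hpq).symm.dvd_of_dvd_mul_left h1
      have := Int.eq_zero_of_abs_lt_dvd h2 (by rw [abs_lt]; omega)
      omega
    · have h1 : (p : ℤ) ∣ (r * q) * (y₀ - y) := by
        have h2 := dvd_add (dvd_sub ((Dvd.intro _ rfl).trans h) hyt)
          (Dvd.intro (r * x) rfl : (p : ℤ) ∣ p * (r * x))
        rwa [show t - r * (p * x + q * y) - (t - r * q * y₀) + p * (r * x) = r * q * (y₀ - y) by
          ring] at h2
      have h2 := (hrp.mul_left hpq.symm).symm.dvd_of_dvd_mul_left h1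
      have := Int.eq_zero_of_abs_lt_dvd h2 (by rw [abs_lt]; omega)
      omega
  · rintro ⟨rfl, rfl⟩
    refine hpq.mul_dvd ?_ ?_
    · convert dvd_sub hyt (Dvd.intro (r * x) rfl : (p : ℤ) ∣ p * (r * x)) using 1
      ring
    · convert dvd_sub hxt (Dvd.intro (r * y) rfl : (q : ℤ) ∣ q * (r * y)) using 1
      ring

theorem sum_sum_ite_mul (a b N : ℕ) (e : ℕ → ℕ → ℕ) (φ : ℕ → ℤ) :
    ∑ m ∈ Finset.range N, (∑ x ∈ Finset.range a, ∑ y ∈ Finset.range b,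
      if m = e x y then (1 : ℤ) else 0) * φ m =
    ∑ x ∈ Finset.range a, ∑ y ∈ Finset.range b, if e x y < N then φ (e x y) else 0 := by
  simp only [Finset.sum_mul]
  rw [Finset.sum_comm]
  refine Finset.sum_congr rfl fun x _ => ?_
  rw [Finset.sum_comm]
  refine Finset.sum_congr rfl fun y _ => ?_
  simp [Finset.sum_ite_eq']

theorem sum_sum_ite_and (a b x₀ y₀ : ℕ) (R : ℕ → ℕ → Prop) [∀ x y, Decidable (R x y)] :
    (∑ x ∈ Finset.range a, ∑ y ∈ Finset.range b,
      if R x y ∧ x = x₀ ∧ y = y₀ then (1 : ℤ) else 0) =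
    if x₀ < a ∧ y₀ < b ∧ R x₀ y₀ then 1 else 0 := by
  by_cases hx : x₀ < a
  · rw [Finset.sum_eq_single_of_mem x₀ (Finset.mem_range.2 hx)
      (fun x _ hne => Finset.sum_eq_zero fun y _ => if_neg fun h => hne h.2.1)]
    by_cases hy : y₀ < b
    · rw [Finset.sum_eq_single_of_mem y₀ (Finset.mem_range.2 hy)
        (fun y _ hne => if_neg fun h => hne h.2.2)]
      simp [hx, hy]
    · rw [if_neg (by tauto)]
      refine Finset.sum_eq_zero fun y hy' => if_neg ?_
      rintro ⟨-, -, rfl⟩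
      exact hy (Finset.mem_range.1 hy')
  · rw [if_neg (by tauto)]
    refine Finset.sum_eq_zero fun x hx' => Finset.sum_eq_zero fun y hy' => if_neg ?_
    rintro ⟨-, rfl, -⟩
    exact hx (Finset.mem_range.1 hx')

/-- By the Chinese remainder theorem the indices m with rm ≡ t modulo pq are those congruent to px₀
+ qy₀. The coefficient 1 can only sit at px₀ + qy₀ itself. As pa + qb = pq + 1, the coefficient -1
can only sit at px₀ + qy₀ - pq, whence the cutoff N + pq in the second term. -/
theorem sum_binary_coeff_residue {p q a a' b b' x₀ y₀ N : ℕ} {r t : ℤ} {P : ℤ[X]}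
    (hp : 0 < p) (hq : 0 < q)
    (hP : P * ((X ^ p - 1) * (X ^ q - 1)) = (X ^ (p * q) - 1) * (X - 1))
    (ha : a + a' = q) (hb : b + b' = p) (hab : a * b = a' * b' + 1)
    (hpq : IsCoprime (p : ℤ) q) (hrp : IsCoprime r (p : ℤ)) (hrq : IsCoprime r (q : ℤ))
    (hx₀ : x₀ < q) (hy₀ : y₀ < p)
    (hxt : (q : ℤ) ∣ t - r * p * x₀) (hyt : (p : ℤ) ∣ t - r * q * y₀) :
    ∑ m ∈ Finset.range N, P.coeff m * (if (p : ℤ) * q ∣ t - r * m then 1 else 0) =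
      (if x₀ < a ∧ y₀ < b ∧ p * x₀ + q * y₀ < N then 1 else 0) -
      if a ≤ x₀ ∧ b ≤ y₀ ∧ p * x₀ + q * y₀ < N + p * q then 1 else 0 := by
  have hrel : p * a + q * b = p * q + 1 := by subst ha hb; nlinarith
  simp only [binary_coeff hp hq hP ha hb hab, sub_mul, Finset.sum_sub_distrib]
  rw [sum_sum_ite_mul, sum_sum_ite_mul]
  congr 1
  · rw [← sum_sum_ite_and a b x₀ y₀ fun x y => p * x + q * y < N]
    refine Finset.sum_congr rfl fun x hx => Finset.sum_congr rfl fun y hy => ?_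
    rw [Finset.mem_range] at hx hy
    have := mul_dvd_sub_iff (x := x) (y := y) hpq hrp hrq (by omega) hx₀ (by omega) hy₀ hxt hyt
    push_cast
    rw [ite_and]
    simp only [this]
  · have key : ∀ i < a', ∀ j < b',
        ((p : ℤ) * q ∣ t - r * ((p * i + q * j + 1 : ℕ) : ℤ)) ↔ a + i = x₀ ∧ b + j = y₀ := by
      intro i hi j hj
      rw [← mul_dvd_sub_iff (x := a + i) (y := b + j) hpq hrp hrq (by omega) hx₀ (by omega) hy₀
        hxt hyt]
      zify at hrel
      push_cast
      rw [show t - r * ((p : ℤ) * i + q * j + 1) = t - r * (p * (a + i) + q * (b + j)) + p * q * r by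
        linear_combination r * hrel]
      exact Int.dvd_add_left ⟨_, rfl⟩
    by_cases hx : a ≤ x₀ ∧ b ≤ y₀
    · obtain ⟨⟨i₀, rfl⟩, j₀, rfl⟩ := And.intro (Nat.exists_eq_add_of_le hx.1)
        (Nat.exists_eq_add_of_le hx.2)
      have e : p * (a + i₀) + q * (b + j₀) = p * i₀ + q * j₀ + 1 + p * q := by linarith
      rw [e]
      have h2 := sum_sum_ite_and a' b' i₀ j₀ fun x y => p * x + q * y + 1 < N
      have e2 : (i₀ < a' ∧ j₀ < b' ∧ p * i₀ + q * j₀ + 1 < N) ↔ (a ≤ a + i₀ ∧ b ≤ b + j₀ ∧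
          p * i₀ + q * j₀ + 1 + p * q < N + p * q) := by omega
      rw [if_congr e2 rfl rfl] at h2
      rw [← h2]
      refine Finset.sum_congr rfl fun x hx => Finset.sum_congr rfl fun y hy => ?_
      rw [Finset.mem_range] at hx hy
      rw [ite_and, if_congr (key x hx y hy) rfl rfl]
      simp only [add_right_inj]
    · rw [if_neg (by tauto)]
      refine Finset.sum_eq_zero fun x hx => Finset.sum_eq_zero fun y hy => ?_
      rw [Finset.mem_range] at hx hy
      rw [if_congr (key x hx y hy) rfl rfl, if_neg (c := _ ∧ _) (by omega), ite_self]

theorem abs_coeff_succ_sub_coeff_le_one {p q r : ℕ} {P Q : ℤ[X]} (hp : 2 < p) (hq : 1 < q)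
    (hr : 0 < r) (hpq : Nat.Coprime p q) (hpr : Nat.Coprime p r) (hqr : Nat.Coprime q r)
    (hP : P * ((X ^ p - 1) * (X ^ q - 1)) = (X ^ (p * q) - 1) * (X - 1))
    (hQ : Q * ((X ^ (p * q) - 1) * (X - 1)) = expand ℤ r P * ((X ^ p - 1) * (X ^ q - 1)))
    (n : ℕ) : |Q.coeff (n + 1) - Q.coeff n| ≤ 1 := by
  obtain ⟨a, a', b, b', ha, hb, hab⟩ := exists_add_eq_and_mul_eq (by omega) hq hpq
  have hpq' := Nat.isCoprime_iff_coprime.2 hpq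
  have hrp := (Nat.isCoprime_iff_coprime.2 hpr).symm
  have hrq := (Nat.isCoprime_iff_coprime.2 hqr).symm
  -- Both coefficients get the same cutoff: if r divides n + 1, the extra term has argument -1,
  -- where `window` vanishes.
  have hext : windowSum P.coeff p q r n (n / r + 1) =
      windowSum P.coeff p q r n ((n + 1) / r + 1) := by
    by_cases h : r ∣ n + 1
    · rw [Nat.succ_div_of_dvd h]
      nth_rw 2 [windowSum]
      rw [Finset.sum_range_succ, ← windowSum]
      obtain ⟨k, hk⟩ := h
      have : n / r + 1 = k := by
        rw [← Nat.succ_div_of_dvd ⟨k, hk⟩, hk, Nat.mul_div_cancel_left _ hr]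
      rw [this]
      have e : (n : ℤ) - r * k = -1 := by
        zify at hk
        linarith
      rw [e, window_neg_one hp hq, mul_zero, add_zero]
    · rw [Nat.succ_div_of_not_dvd h]
  rw [coeff_eq_windowSum (by omega) hq hr hQ, coeff_eq_windowSum (by omega) hq hr hQ, hext]
  generalize (n + 1) / r + 1 = N
  push_cast
  obtain ⟨t, ht⟩ : ∃ t : ℤ, t = n + 1 := ⟨_, rfl⟩
  rw [← ht, show (n : ℤ) = t - 1 by omega]
  -- The x-coordinate depends on t modulo q and the y-coordinate on t modulo p. Hence t, t - p, t -
  -- q, t - p - q have coordinates (x₀, y₀), (x₁, y₀), (x₀, y₁), (x₁, y₁).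
  obtain ⟨x₀, hx₀, hx₀t⟩ := exists_lt_dvd_sub_mul (by omega) (hrq.mul_left hpq') t
  obtain ⟨x₁, hx₁, hx₁t⟩ := exists_lt_dvd_sub_mul (by omega) (hrq.mul_left hpq') (t - p)
  obtain ⟨y₀, hy₀, hy₀t⟩ := exists_lt_dvd_sub_mul (by omega) (hrp.mul_left hpq'.symm) t
  obtain ⟨y₁, hy₁, hy₁t⟩ := exists_lt_dvd_sub_mul (by omega) (hrp.mul_left hpq'.symm) (t - q)
  have hx₀t' : (q : ℤ) ∣ t - q - r * p * x₀ := by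
    rw [sub_right_comm]
    exact dvd_sub_self_right.2 hx₀t
  have hx₁t' : (q : ℤ) ∣ t - p - q - r * p * x₁ := by
    rw [sub_right_comm]
    exact dvd_sub_self_right.2 hx₁t
  have hy₀t' : (p : ℤ) ∣ t - p - r * q * y₀ := by
    rw [sub_right_comm]
    exact dvd_sub_self_right.2 hy₀t
  have hy₁t' : (p : ℤ) ∣ t - p - q - r * q * y₁ := by
    rw [sub_right_comm t, sub_right_comm]
    exact dvd_sub_self_right.2 hy₁t
  have hs {x y : ℕ} {t : ℤ} := sum_binary_coeff_residue (x₀ := x) (y₀ := y) (N := N) (r := r)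
    (t := t) (by omega) (by omega) hP ha hb hab hpq' hrp hrq
  have hdiff : windowSum P.coeff p q r t N - windowSum P.coeff p q r (t - 1) N =
      ∑ m ∈ Finset.range N, P.coeff m * (if (p : ℤ) * q ∣ t - r * m then 1 else 0) -
      ∑ m ∈ Finset.range N, P.coeff m * (if (p : ℤ) * q ∣ t - p - r * m then 1 else 0) -
      ∑ m ∈ Finset.range N, P.coeff m * (if (p : ℤ) * q ∣ t - q - r * m then 1 else 0) +
      ∑ m ∈ Finset.range N, P.coeff m * (if (p : ℤ) * q ∣ t - p - q - r * m then 1 else 0) := by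
    simp only [windowSum, ← Finset.sum_sub_distrib, ← Finset.sum_add_distrib, ← mul_sub, ← mul_add]
    refine Finset.sum_congr rfl fun m _ => ?_
    have := window_sub (p := p) (q := q) (by omega) hq (t - r * m)
    rw [sub_right_comm t 1, this]
    simp only [sub_right_comm _ (r * m : ℤ)]
  rw [hdiff, hs hx₀ hy₀ hx₀t hy₀t, hs hx₁ hy₀ hx₁t hy₀t', hs hx₀ hy₁ hx₀t' hy₁t,
    hs hx₁ hy₁ hx₁t' hy₁t', abs_le]
  generalize p * x₀ = u₀
  generalize p * x₁ = u₁
  generalize q * y₀ = v₀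
  generalize q * y₁ = v₁
  generalize p * q = M
  -- A total of ±2 would need one diagonal of the rectangle below a cutoff and the other not; both
  -- diagonals have the sum u₀ + u₁ + v₀ + v₁.
  constructor <;> split_ifs <;> omega

/-! ### Discrete intermediate values. -/

theorem exists_eq_of_abs_succ_sub_le_one {f : ℕ → ℤ} (hf : ∀ n, |f (n + 1) - f n| ≤ 1)
    {i j : ℕ} (hij : i ≤ j) {z : ℤ} (hi : f i ≤ z) (hj : z ≤ f j) : ∃ n ≤ j, f n = z := by
  induction j, hij using Nat.le_induction with
  | base => exact ⟨i, le_rfl, le_antisymm hi hj⟩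
  | succ j _ ih =>
    by_cases h : z ≤ f j
    · obtain ⟨n, hn, e⟩ := ih h
      exact ⟨n, by omega, e⟩
    · have := abs_le.1 (hf j)
      exact ⟨j + 1, le_rfl, by omega⟩

theorem mem_coeffSet {Q : ℤ[X]} {z : ℤ} : z ∈ coeffSet Q ↔ ∃ n ≤ Q.natDegree, Q.coeff n = z := by
  simp [coeffSet]

theorem coeffSet_eq_Icc {Q : ℤ[X]} (h : ∀ n, |Q.coeff (n + 1) - Q.coeff n| ≤ 1) :
    coeffSet Q = Finset.Icc (minCoeff Q) (maxCoeff Q) := by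
  ext z
  rw [Finset.mem_Icc]
  refine ⟨fun hz => ⟨Finset.min'_le _ _ hz, Finset.le_max' _ _ hz⟩, fun ⟨h1, h2⟩ => ?_⟩
  obtain ⟨i, hi, ei⟩ := mem_coeffSet.1 ((coeffSet Q).min'_mem (coeffSet_nonempty Q))
  obtain ⟨j, hj, ej⟩ := mem_coeffSet.1 ((coeffSet Q).max'_mem (coeffSet_nonempty Q))
  rw [minCoeff, ← ei] at h1
  rw [maxCoeff, ← ej] at h2
  rw [mem_coeffSet]
  rcases le_total i j with hij | hij
  · obtain ⟨n, hn, e⟩ := exists_eq_of_abs_succ_sub_le_one h hij h1 h2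
    exact ⟨n, by omega, e⟩
  -- If the maximum comes before the minimum, negation restores an ascent.
  · obtain ⟨n, hn, e⟩ := exists_eq_of_abs_succ_sub_le_one (f := fun n => -Q.coeff n) (z := -z)
      (fun n => by rw [neg_sub_neg, abs_sub_comm]; exact h n) hij (by omega) (by omega)
    exact ⟨n, by omega, by omega⟩

/-! ### Comparing arbitrary truncated sums with coefficients. -/

theorem windowSum_succ (c : ℕ → ℤ) (p q : ℕ) (r t : ℤ) (N : ℕ) :
    windowSum c p q r t (N + 1) = windowSum c p q r t N + c N * window p q (t - r * N) :=
  Finset.sum_range_succ _ _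

theorem windowSum_congr {c : ℕ → ℤ} {p q : ℕ} {r s t u : ℤ} (hrs : r ≡ s [ZMOD ((p : ℤ) * q)])
    (htu : t ≡ u [ZMOD ((p : ℤ) * q)]) (N : ℕ) :
    windowSum c p q r t N = windowSum c p q s u N :=
  Finset.sum_congr rfl fun m _ => by rw [window_congr (htu.sub (hrs.mul_right m))]

theorem windowSum_neg {c : ℕ → ℤ} {p q : ℕ} (hp : 0 < p) (hq : 0 < q) (r t : ℤ) (N : ℕ) :
    windowSum c p q (-r) t N = -windowSum c p q r (p + q - 1 - t) N := by
  rw [windowSum, windowSum, ← Finset.sum_neg_distrib]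
  refine Finset.sum_congr rfl fun m _ => ?_
  rw [← neg_neg (window p q (t - -r * m)), ← window_reflect hp hq]
  ring_nf

/-- An integer where `window` does not vanish is congruent to some `i` in `[0, p)`, where it takes
the value `1`, or in `[q, q + p)`, where it takes the value `-1`. -/
theorem exists_window_residue {p q : ℕ} (hp : 1 < p) (hpq : p < q) {t : ℤ}
    (h : window p q t ≠ 0) :
    ∃ i : ℕ, (i : ℤ) ≡ t [ZMOD ((p : ℤ) * q)] ∧
      (i < p ∧ window p q t = 1 ∨ q ≤ i ∧ i < q + p ∧ window p q t = -1) := by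
  have hM : (0 : ℤ) < (p : ℤ) * q := by exact_mod_cast Nat.mul_pos (by omega) (by omega)
  obtain ⟨i, hi⟩ := Int.eq_ofNat_of_zero_le (Int.emod_nonneg t hM.ne')
  have hlt := Int.emod_lt_of_pos t hM
  rw [hi] at hlt
  have hit : (i : ℤ) ≡ t [ZMOD ((p : ℤ) * q)] := hi ▸ Int.mod_modEq _ _
  have hw := window_of_lt (q := q) hp (by omega) (n := i) (by exact_mod_cast hlt)
  rw [window_congr hit] at hw
  refine ⟨i, hit, ?_⟩
  rw [hw] at h ⊢
  split_ifs at h ⊢ <;> omega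

/-- If `q < r`, every value of `windowSum` is at most some coefficient of `Q` (`ε = 1`) and at least
some coefficient of `Q` (`ε = -1`). -/
theorem exists_windowSum_le_coeff {p q r : ℕ} {P Q : ℤ[X]} (hp : 1 < p) (hpq' : p < q)
    (hr : q < r) (hpq : Nat.Coprime p q)
    (hP : P * ((X ^ p - 1) * (X ^ q - 1)) = (X ^ (p * q) - 1) * (X - 1))
    (hQ : Q * ((X ^ (p * q) - 1) * (X - 1)) = expand ℤ r P * ((X ^ p - 1) * (X ^ q - 1)))
    (h0 : ∃ n, Q.coeff n = 0) (t : ℤ) (N : ℕ) {ε : ℤ} (hε : ε = 1 ∨ ε = -1) :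
    ∃ n, ε * windowSum P.coeff p q r t N ≤ ε * Q.coeff n := by
  induction N with
  | zero =>
    obtain ⟨n, hn⟩ := h0
    exact ⟨n, by simp [windowSum, hn]⟩
  | succ N ih =>
    -- A last term that does not help is dropped. Otherwise t can be replaced by rN + i, a genuine
    -- coefficient index.
    by_cases hle : ε * (P.coeff N * window p q (t - r * N)) ≤ 0
    · obtain ⟨n, hn⟩ := ih
      exact ⟨n, by rw [windowSum_succ]; linarith⟩
    have hw : window p q (t - r * N) ≠ 0 := by
      rintro h
      simp [h] at hle
    obtain ⟨i, hi, hcase⟩ := exists_window_residue hp hpq' hw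
    have hcong : t ≡ ((r * N + i : ℕ) : ℤ) [ZMOD ((p : ℤ) * q)] := by
      have := (hi.add_left (r * N)).symm
      push_cast
      rwa [add_sub_cancel] at this
    refine ⟨r * N + i, ?_⟩
    rw [coeff_eq_windowSum hp (by omega) (by omega) hQ, windowSum_congr (Int.ModEq.refl _) hcong]
    by_cases hir : i < r
    · rw [Nat.mul_add_div (by omega), Nat.div_eq_of_lt hir, add_zero]
    -- For i ≥ r the coefficient has one further term, `c (N + 1)` times 1. Here `window` is -1 at
    -- the previous term, so ε `c N` < 0, and the sign rule for P gives ε `c (N + 1)` ≥ 0.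
    · obtain ⟨-, hiq, hw1⟩ : q ≤ i ∧ i < q + p ∧ window p q (t - r * N) = -1 := by
        rcases hcase with h | h
        · omega
        · exact h
      obtain ⟨k, rfl⟩ := Nat.exists_eq_add_of_le (not_lt.1 hir)
      have hkp : k < p := by omega
      have hkM : k < p * q := by nlinarith
      have hdiv : (r * N + (r + k)) / r = N + 1 := by
        rw [← add_assoc, ← Nat.mul_succ, Nat.mul_add_div (by omega), Nat.div_eq_of_lt (by omega),
          add_zero]
      have hwk : window p q (((r * N + (r + k) : ℕ) : ℤ) - r * ((N + 1 : ℕ) : ℤ)) = 1 := by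
        rw [show ((r * N + (r + k) : ℕ) : ℤ) - r * ((N + 1 : ℕ) : ℤ) = (k : ℤ) by push_cast; ring,
          window_of_lt hp (by omega) hkM, if_pos hkp, if_neg (by omega), sub_zero]
      rw [hdiv, windowSum_succ _ _ _ _ _ (N + 1), hwk, mul_one, mul_add]
      rw [hw1] at hle
      have hneg := binary_coeff_not_both_neg hp (by omega) hpq hP N
      have hpos := binary_coeff_not_both_pos hp (by omega) hpq hP N
      rcases hε with rfl | rfl
      · have := hneg (by linarith)
        linarith
      · have := hpos (by linarith)
        linarith

/-! ### Ternary polynomials. -/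

theorem natDegree_of_mul_eq {p q r : ℕ} {Q : ℤ[X]} (hp : 0 < p) (hq : 0 < q) (hr : 0 < r)
    (hQ : ((X ^ (p * q) - 1) * (X ^ (p * r) - 1) * (X ^ (q * r) - 1) * (X - 1)) * Q =
      (X ^ (p * q * r) - 1) * (X ^ p - 1) * (X ^ q - 1) * (X ^ r - 1)) :
    p * q + p * r + q * r + 1 + Q.natDegree = p * q * r + p + q + r := by
  have hm : ∀ {n : ℕ}, 0 < n → (X ^ n - 1 : ℤ[X]).Monic := fun hn => by
    simpa using monic_X_pow_sub_C (1 : ℤ) hn.ne'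
  have hd : ∀ n : ℕ, (X ^ n - 1 : ℤ[X]).natDegree = n := fun n => by
    simpa using natDegree_X_pow_sub_C (n := n) (r := (1 : ℤ))
  have h1 : (X - 1 : ℤ[X]).Monic := by simpa using monic_X_sub_C (1 : ℤ)
  have hd1 : (X - 1 : ℤ[X]).natDegree = 1 := by simpa using natDegree_X_sub_C (1 : ℤ)
  have m1 := hm (mul_pos hp hq)
  have m2 := hm (mul_pos hp hr)
  have m3 := hm (mul_pos hq hr)
  have m4 := hm (mul_pos (mul_pos hp hq) hr)
  have hnum := ((m4.mul (hm hp)).mul (hm hq)).mul (hm hr)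
  have hQm : Q.Monic := (((m1.mul m2).mul m3).mul h1).of_mul_monic_left (hQ ▸ hnum)
  have := congrArg natDegree hQ
  rwa [(((m1.mul m2).mul m3).mul h1).natDegree_mul hQm, ((m1.mul m2).mul m3).natDegree_mul h1,
    (m1.mul m2).natDegree_mul m3, m1.natDegree_mul m2,
    ((m4.mul (hm hp)).mul (hm hq)).natDegree_mul (hm hr),
    (m4.mul (hm hp)).natDegree_mul (hm hq), m4.natDegree_mul (hm hp), hd, hd, hd, hd, hd, hd, hd,
    hd1] at this

/-- `Q` is the ternary inclusion-exclusion polynomial of `p`, `q`, `r`. -/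
def IsTernary (p q r : ℕ) (Q : ℤ[X]) : Prop :=
  ((X ^ (p * q) - 1) * (X ^ (p * r) - 1) * (X ^ (q * r) - 1) * (X - 1)) * Q =
      (X ^ (p * q * r) - 1) * (X ^ p - 1) * (X ^ q - 1) * (X ^ r - 1)

theorem X_pow_sub_one_ne_zero {n : ℕ} (hn : 0 < n) : (X ^ n - 1 : ℤ[X]) ≠ 0 := by
  simpa using (monic_X_pow_sub_C (1 : ℤ) hn.ne').ne_zero

theorem IsTernary.mul_eq_expand {p q r : ℕ} {P Q : ℤ[X]} (hp : 0 < p) (hq : 0 < q) (hr : 0 < r)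
    (h : IsTernary p q r Q)
    (hP : P * ((X ^ p - 1) * (X ^ q - 1)) = (X ^ (p * q) - 1) * (X - 1)) :
    Q * ((X ^ (p * q) - 1) * (X - 1)) = expand ℤ r P * ((X ^ p - 1) * (X ^ q - 1)) := by
  refine mul_right_cancel₀ (mul_ne_zero (X_pow_sub_one_ne_zero (mul_pos hp hr))
    (X_pow_sub_one_ne_zero (mul_pos hq hr))) ?_
  have e := congrArg (expand ℤ r) hP
  simp only [map_mul, map_sub, map_pow, map_one, expand_X, ← pow_mul] at e
  rw [IsTernary] at h
  rw [mul_comm r p, mul_comm r q, mul_comm r (p * q)] at e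
  linear_combination h - (X ^ p - 1) * (X ^ q - 1) * e

theorem exists_binary {p q : ℕ} (hp : 1 < p) (hq : 1 < q) (h : Nat.Coprime p q) :
    ∃ P : ℤ[X], P * ((X ^ p - 1) * (X ^ q - 1)) = (X ^ (p * q) - 1) * (X - 1) := by
  have hne : p ≠ q := by
    rintro rfl
    rw [Nat.coprime_self] at h
    omega
  refine ⟨inclExclPoly {p, q}, ?_⟩
  have hmul := inclExclDen_mul_inclExclPoly {p, q}
    (by simp only [Finset.mem_insert, Finset.mem_singleton]; omega)
    (by
      rw [Finset.coe_pair]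
      exact Set.pairwise_pair.2 fun _ => ⟨h, h.symm⟩)
  have e1 : ({p, q} : Finset ℕ) \ {q} = {p} := by ext; simp; omega
  have e2 : ({q} : Finset ℕ) \ {p} = {q} := by ext; simp; omega
  have e3 : ({q} : Finset ℕ) \ {p, q} = ∅ := by ext; simp; omega
  simp only [inclExclDen, inclExclNum, Finset.prod_filter] at hmul
  rw [show ({p, q} : Finset ℕ) = insert p (insert q ∅) from rfl] at hmul
  rw [Finset.prod_powerset_insert (by simp [hne]), Finset.prod_powerset_insert (by simp),
    Finset.prod_powerset_insert (by simp), Finset.prod_powerset_insert (by simp [hne]),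
    Finset.prod_powerset_insert (by simp), Finset.prod_powerset_insert (by simp)] at hmul
  simp [e1, e2, e3, hne, show ¬Odd 2 by decide] at hmul
  linear_combination hmul

theorem IsTernary.swap {p q r : ℕ} {Q : ℤ[X]} (h : IsTernary p q r Q) : IsTernary q p r Q := by
  rw [IsTernary] at h ⊢
  rw [mul_comm q p]
  linear_combination h

theorem IsTernary.abs_coeff_succ_sub_coeff_le_one {p q r : ℕ} {Q : ℤ[X]} (hp : 2 < p) (hq : 2 < q)
    (hr : 0 < r) (hpq : Nat.Coprime p q) (hpr : Nat.Coprime p r) (hqr : Nat.Coprime q r)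
    (h : IsTernary p q r Q) (n : ℕ) : |Q.coeff (n + 1) - Q.coeff n| ≤ 1 := by
  obtain ⟨P, hP⟩ := exists_binary (by omega) (by omega) hpq
  exact _root_.abs_coeff_succ_sub_coeff_le_one hp (by omega) hr hpq hpr hqr hP
    (h.mul_eq_expand (by omega) (by omega) hr hP) n

/-- The right-hand side involves r only through its class modulo pq, which makes different r
comparable. -/
theorem IsTernary.mem_coeffSet_iff {p q r : ℕ} {P Q : ℤ[X]} (hp : 2 < p) (hpq' : p < q)
    (hr : q < r) (hpq : Nat.Coprime p q) (hpr : Nat.Coprime p r) (hqr : Nat.Coprime q r)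
    (h : IsTernary p q r Q)
    (hP : P * ((X ^ p - 1) * (X ^ q - 1)) = (X ^ (p * q) - 1) * (X - 1)) (z : ℤ) :
    z ∈ coeffSet Q ↔ (∃ t N, windowSum P.coeff p q r t N ≤ z) ∧
      ∃ t N, z ≤ windowSum P.coeff p q r t N := by
  have hQ := h.mul_eq_expand (by omega) (by omega) (by omega) hP
  have hcoeff := coeff_eq_windowSum (by omega) (by omega) (by omega) hQ
  have hdeg : p ≤ Q.natDegree := by
    have := natDegree_of_mul_eq (by omega) (by omega) (by omega) h
    zify at this hp hpq' hr ⊢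
    have e : (Q.natDegree : ℤ) = (p - 1) * (q - 1) * (r - 1) := by linear_combination this
    have h1 : (1 : ℤ) ≤ (p - 1) * (q - 1) := by nlinarith
    nlinarith
  -- Since p < r only m = 0 contributes, and p lies between the two blocks of `window`. This zero
  -- starts the induction and accounts for the coefficients beyond the degree.
  have hp0 : Q.coeff p = 0 := by
    rw [hcoeff, Nat.div_eq_of_lt (by omega), windowSum_succ, windowSum]
    rw [Finset.sum_range_zero, Nat.cast_zero, mul_zero, sub_zero,
      window_of_lt (by omega) (by omega) (by nlinarith), if_neg (by omega), if_neg (by omega)]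
    simp
  have hmem : ∀ n, Q.coeff n ∈ coeffSet Q := by
    intro n
    by_cases hn : n ≤ Q.natDegree
    · exact mem_coeffSet.2 ⟨n, hn, rfl⟩
    · rw [coeff_eq_zero_of_natDegree_lt (by omega)]
      exact mem_coeffSet.2 ⟨p, hdeg, hp0⟩
  have hle := exists_windowSum_le_coeff (by omega) hpq' hr hpq hP hQ ⟨p, hp0⟩
  constructor
  · intro hz
    obtain ⟨n, -, rfl⟩ := mem_coeffSet.1 hz
    exact ⟨⟨n, _, (hcoeff n).ge⟩, n, _, (hcoeff n).le⟩
  · rintro ⟨⟨t, N, h1⟩, u, M, h2⟩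
    rw [coeffSet_eq_Icc (h.abs_coeff_succ_sub_coeff_le_one hp (by omega) (by omega) hpq hpr hqr),
      Finset.mem_Icc]
    obtain ⟨n, hn⟩ := hle t N (Or.inr rfl)
    obtain ⟨m, hm⟩ := hle u M (Or.inl rfl)
    have e1 : minCoeff Q ≤ _ := Finset.min'_le _ _ (hmem n)
    have e2 : _ ≤ maxCoeff Q := Finset.le_max' _ _ (hmem m)
    constructor <;> linarith

theorem IsTernary.coeffSet_eq_of_lt {p q r s : ℕ} {Q R : ℤ[X]} (hp : 2 < p) (hpq' : p < q)
    (hr : q < r) (hs : q < s) (hpq : Nat.Coprime p q) (hpr : Nat.Coprime p r)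
    (hqr : Nat.Coprime q r) (hps : Nat.Coprime p s) (hqs : Nat.Coprime q s)
    (hQ : IsTernary p q r Q) (hR : IsTernary p q s R) :
    ((r : ℤ) ≡ s [ZMOD ((p : ℤ) * q)] → coeffSet Q = coeffSet R) ∧
    ((r : ℤ) ≡ -s [ZMOD ((p : ℤ) * q)] → coeffSet Q = -coeffSet R) := by
  obtain ⟨P, hP⟩ := exists_binary (by omega) (by omega) hpq
  have h1 := hQ.mem_coeffSet_iff hp hpq' hr hpq hpr hqr hP
  have h2 := hR.mem_coeffSet_iff hp hpq' hs hpq hps hqs hP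
  constructor
  · intro h
    ext z
    rw [h1, h2]
    simp only [windowSum_congr h (Int.ModEq.refl _)]
  · intro h
    ext z
    have hneg : ∀ t N, windowSum P.coeff p q r t N =
        -windowSum P.coeff p q s (p + q - 1 - t) N := fun t N => by
      rw [windowSum_congr h (Int.ModEq.refl _), windowSum_neg (by omega) (by omega)]
    rw [Finset.mem_neg', h1, h2]
    simp only [hneg]
    constructor
    · rintro ⟨⟨t, N, e⟩, u, M, e'⟩
      exact ⟨⟨_, M, le_neg.1 e'⟩, _, N, neg_le.1 e⟩
    · rintro ⟨⟨t, N, e⟩, u, M, e'⟩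
      exact ⟨⟨p + q - 1 - u, M, by rw [sub_sub_cancel]; exact neg_le.1 e'⟩, p + q - 1 - t, N,
        by rw [sub_sub_cancel]; exact le_neg.1 e⟩

theorem IsTernary.coeffSet_eq {p q r s : ℕ} {Q R : ℤ[X]} (hp : 2 < p) (hq : 2 < q)
    (hr : max p q < r) (hs : max p q < s) (hpq : Nat.Coprime p q) (hpr : Nat.Coprime p r)
    (hqr : Nat.Coprime q r) (hps : Nat.Coprime p s) (hqs : Nat.Coprime q s)
    (hQ : IsTernary p q r Q) (hR : IsTernary p q s R) :
    ((r : ℤ) ≡ s [ZMOD ((p : ℤ) * q)] → coeffSet Q = coeffSet R) ∧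
    ((r : ℤ) ≡ -s [ZMOD ((p : ℤ) * q)] → coeffSet Q = -coeffSet R) := by
  rw [max_lt_iff] at hr hs
  rcases lt_trichotomy p q with h | rfl | h
  · exact hQ.coeffSet_eq_of_lt hp h hr.2 hs.2 hpq hpr hqr hps hqs hR
  · rw [Nat.coprime_self] at hpq
    omega
  · rw [mul_comm (p : ℤ)]
    exact hQ.swap.coeffSet_eq_of_lt hq h hr.1 hs.1 hpq.symm hqr hpr hqs hps hR.swap

/-! ### The two instances and the final statement. -/

theorem isTernary_inclExclPoly {p q r : ℕ} (hp : 1 < p) (hq : 1 < q) (hr : 1 < r)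
    (hpq : Nat.Coprime p q) (hpr : Nat.Coprime p r) (hqr : Nat.Coprime q r) :
    IsTernary p q r (inclExclPoly {p, q, r}) := by
  have hne : ∀ {a b : ℕ}, 1 < a → Nat.Coprime a b → a ≠ b := by
    rintro a _ ha h rfl
    rw [Nat.coprime_self] at h
    omega
  have npq := hne hp hpq
  have npr := hne hp hpr
  have nqr := hne hq hqr
  have hmul := inclExclDen_mul_inclExclPoly {p, q, r}
    (by simp only [Finset.mem_insert, Finset.mem_singleton]; omega)
    (by
      intro a ha b hb hab
      simp only [Finset.coe_insert, Finset.coe_singleton, Set.mem_insert_iff,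
        Set.mem_singleton_iff] at ha hb
      rcases ha with rfl | rfl | rfl <;> rcases hb with rfl | rfl | rfl <;>
        first | exact absurd rfl hab | assumption | (apply Nat.Coprime.symm; assumption))
  have e1 : ({p, q, r} : Finset ℕ) \ {q} = {p, r} := by ext; simp; omega
  have e2 : ({p, q, r} : Finset ℕ) \ {r} = {p, q} := by ext; simp; omega
  have e3 : ({p, q, r} : Finset ℕ) \ {q, r} = {p} := by ext; simp; omega
  have e4 : ({q, r} : Finset ℕ) \ {p} = {q, r} := by ext; simp; omega
  have e5 : ({q, r} : Finset ℕ) \ {p, r} = {q} := by ext; simp; omega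
  have e6 : ({q, r} : Finset ℕ) \ {p, q} = {r} := by ext; simp; omega
  have e7 : ({q, r} : Finset ℕ) \ {p, q, r} = ∅ := by ext; simp; omega
  simp only [inclExclDen, inclExclNum, Finset.prod_filter] at hmul
  rw [show ({p, q, r} : Finset ℕ) = insert p (insert q (insert r ∅)) from rfl] at hmul
  iterate 2
    rw [Finset.prod_powerset_insert (by simp [npq, npr]),
      Finset.prod_powerset_insert (by simp [nqr]), Finset.prod_powerset_insert (by simp),
      Finset.prod_powerset_insert (by simp), Finset.prod_powerset_insert (by simp [nqr]),
      Finset.prod_powerset_insert (by simp), Finset.prod_powerset_insert (by simp)] at hmul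
  simp [e1, e2, e3, e4, e5, e6, e7, npq, npr, nqr, show ¬Odd 2 by decide, show Odd 3 by decide,
    show ¬Even 3 by decide, Finset.prod_insert] at hmul
  rw [IsTernary]
  linear_combination hmul

/-- Apply Φ_n(z^ℓ) = Φ_{nℓ}(z) Φ_n(z), for a prime ℓ not dividing n, first to n = p and then to n =
pq. -/
theorem isTernary_cyclotomic {p q r : ℕ} (hp : p.Prime) (hq : q.Prime) (hr : r.Prime)
    (hpq : p ≠ q) (hpr : p ≠ r) (hqr : q ≠ r) : IsTernary p q r (cyclotomic (p * q * r) ℤ) := by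
  have : Fact p.Prime := ⟨hp⟩
  have hpq2 : ¬q ∣ p := fun h => hpq ((Nat.prime_dvd_prime_iff_eq hq hp).1 h).symm
  have hpqr : ¬r ∣ p * q := fun h => (hr.dvd_mul.1 h).elim
    (fun h => hpr ((Nat.prime_dvd_prime_iff_eq hr hp).1 h).symm)
    (fun h => hqr ((Nat.prime_dvd_prime_iff_eq hr hq).1 h).symm)
  have e1 := cyclotomic_prime_mul_X_sub_one ℤ p
  have e2 := cyclotomic_expand_eq_cyclotomic_mul hq hpq2 ℤ
  have e3 := cyclotomic_expand_eq_cyclotomic_mul hr hpqr ℤ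
  have e1q := congrArg (expand ℤ q) e1
  simp only [map_mul, map_sub, map_pow, map_one, expand_X, ← pow_mul] at e1q
  have hP : cyclotomic (p * q) ℤ * ((X ^ p - 1) * (X ^ q - 1)) = (X ^ (p * q) - 1) * (X - 1) := by
    rw [mul_comm p q, ← e1q, e2, mul_comm p q, ← e1]
    ring
  have hPr := congrArg (expand ℤ r) hP
  simp only [map_mul, map_sub, map_pow, map_one, expand_X, ← pow_mul] at hPr
  rw [IsTernary]
  rw [mul_comm r p, mul_comm r q, mul_comm r (p * q), e3] at hPr
  linear_combination (X ^ p - 1) * (X ^ q - 1) * hPr -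
    cyclotomic (p * q * r) ℤ * (X ^ (p * r) - 1) * (X ^ (q * r) - 1) * hP

theorem theorem3 (p q : ℕ) (hp : 3 ≤ p) (hq : 3 ≤ q) (hpq : Nat.Coprime p q) :
    (∀ r : ℕ, 3 ≤ r → Nat.Coprime p r → Nat.Coprime q r →
      coeffSet (inclExclPoly {p, q, r}) =
        Finset.Icc (minCoeff (inclExclPoly {p, q, r})) (maxCoeff (inclExclPoly {p, q, r}))) ∧
    (∀ r s : ℕ, max p q < r → max p q < s →
      Nat.Coprime p r → Nat.Coprime q r → Nat.Coprime p s → Nat.Coprime q s →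
      ((r : ℤ) ≡ (s : ℤ) [ZMOD ((p : ℤ) * (q : ℤ))] →
        coeffSet (inclExclPoly {p, q, r}) = coeffSet (inclExclPoly {p, q, s})) ∧
      ((r : ℤ) ≡ -(s : ℤ) [ZMOD ((p : ℤ) * (q : ℤ))] →
        coeffSet (inclExclPoly {p, q, r}) = -coeffSet (inclExclPoly {p, q, s}))) ∧
    (p.Prime → q.Prime →
      (∀ r : ℕ, r.Prime → 3 ≤ r → r ≠ p → r ≠ q →
        coeffSet (cyclotomic (p * q * r) ℤ) =
          Finset.Icc (minCoeff (cyclotomic (p * q * r) ℤ))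
            (maxCoeff (cyclotomic (p * q * r) ℤ))) ∧
      (∀ r s : ℕ, r.Prime → s.Prime → max p q < r → max p q < s →
        ((r : ℤ) ≡ (s : ℤ) [ZMOD ((p : ℤ) * (q : ℤ))] →
          coeffSet (cyclotomic (p * q * r) ℤ) = coeffSet (cyclotomic (p * q * s) ℤ)) ∧
        ((r : ℤ) ≡ -(s : ℤ) [ZMOD ((p : ℤ) * (q : ℤ))] →
          coeffSet (cyclotomic (p * q * r) ℤ) = -coeffSet (cyclotomic (p * q * s) ℤ)))) := by
  have hne : p ≠ q := by
    rintro rfl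
    rw [Nat.coprime_self] at hpq
    omega
  refine ⟨fun r hr hpr hqr => ?_, fun r s hr hs hpr hqr hps hqs => ?_, fun pp pq => ⟨?_, ?_⟩⟩
  · exact coeffSet_eq_Icc ((isTernary_inclExclPoly (by omega) (by omega) (by omega) hpq hpr
      hqr).abs_coeff_succ_sub_coeff_le_one hp hq (by omega) hpq hpr hqr)
  · exact (isTernary_inclExclPoly (by omega) (by omega) (by omega) hpq hpr hqr).coeffSet_eq hp hq
      hr hs hpq hpr hqr hps hqs
      (isTernary_inclExclPoly (by omega) (by omega) (by omega) hpq hps hqs)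
  · intro r pr _ hrp hrq
    exact coeffSet_eq_Icc ((isTernary_cyclotomic pp pq pr hne hrp.symm
      hrq.symm).abs_coeff_succ_sub_coeff_le_one hp hq pr.pos hpq
      ((Nat.coprime_primes pp pr).2 hrp.symm) ((Nat.coprime_primes pq pr).2 hrq.symm))
  · intro r s pr ps hr hs
    have hpr : p ≠ r := by omega
    have hqr : q ≠ r := by omega
    have hps : p ≠ s := by omega
    have hqs : q ≠ s := by omega
    exact (isTernary_cyclotomic pp pq pr hne hpr hqr).coeffSet_eq hp hq hr hs hpq
      ((Nat.coprime_primes pp pr).2 hpr) ((Nat.coprime_primes pq pr).2 hqr)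
      ((Nat.coprime_primes pp ps).2 hps) ((Nat.coprime_primes pq ps).2 hqs)
      (isTernary_cyclotomic pp pq ps hne hps hqs)
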